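/- Packets of integer length between $1$ and $L$ bytes, each requiring an integer number of processing cycles between $1$ and $k$, arrive at a buffer with a capacity of $B$ bytes. Time is slotted. In each slot, first all stored packets with no residual cycles are transmitted and leave the buffer; then the packets of the slot arrive one after the other, and may be admitted or rejected, and stored packets may be pushed out (a packet dropped before its transmission is lost); then a single stored packet may be processed, which reduces its residual cycles by one. The push-out policy $PO$ under SRPT (shortest remaining processing time) priority keeps its buffer ordered by non-decreasing residual cycles, with ties broken arbitrarily. When a packet $p$ arrives, $PO$ inserts $p$ into this order and then, as long as the last packet in the order starts above byte position $B-2L+1$ (positions are counted from $1$), drops the last packet. In every slot it processes the first packet of its buffer. Let $\sigma$ be a finite arrival sequence. Let $PO(\sigma)$ be the overall length of all packets that $PO$ transmits on $\sigma$ when it runs until there are no more arrivals and its buffer is empty, and let $L_a$ be the average length of these packets. Let $OPT(\sigma)$ be the maximal overall length of packets transmitted on $\sigma$ by any (possibly offline and clairvoyant) schedule with a buffer of $B$ bytes, which may admit, push out and process packets in any way allowed by the model. **Corollary.** If $B > 4L^2-2L$, then $PO$ is at most $\frac{2L}{L_a}$-competitive for SRPT-based priorities: for every finite arrival sequence $\sigma$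 (containing at least one packet), $$OPT(\sigma)\;\le\;\frac{2L}{L_a}\,PO(\sigma).$$ -/

import Mathlib

/-- A packet, as seen at some moment: its length in bytes, and the number of processing cycles it
still requires before it can be transmitted.  At its arrival, `cycles` is the total number of
required cycles; while it is stored it is the residual number. -/
structure Packet where
  size : ℕ
  cycles : ℕ

namespace Packet

/-- Admissible arriving packets: length in `{1, …, L}`, required work in `{1, …, k}`. -/
def Admissible (L k : ℕ) (p : Packet) : Prop :=
  (1 ≤ p.size ∧ p.size ≤ L) ∧ (1 ≤ p.cycles ∧ p.cycles ≤ k)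

/-- The packet after one cycle of processing. -/
def serve (p : Packet) : Packet := { p with cycles := p.cycles - 1 }

/-- The overall length of a list of packets. -/
def bytes (l : List Packet) : ℕ := (l.map Packet.size).sum

/-- The average length of the packets of a list. -/
noncomputable def averageLength (l : List Packet) : ℝ := (bytes l : ℝ) / (l.length : ℝ)

/-- An arrival sequence lists, slot by slot, the packets arriving in that slot, in their order of
arrival.  There are no arrivals after the last listed slot. -/
abbrev Arrivals : Type := List (List Packet)

/-- The buffer is in SRPT priority order: least residual work first. -/
def SRPTOrdered (buf : List Packet) : Prop := buf.Pairwise (fun p q => p.cycles ≤ q.cycles)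

/-- The position of the first byte of the last packet of the buffer; positions are counted
from `1`. -/
def lastStart (buf : List Packet) : ℕ := bytes buf.dropLast + 1

/-- The loop of `PO`: while the last packet starts above position `B - 2L + 1`, drop it. -/
def trim (B L : ℕ) (buf : List Packet) : List Packet :=
  if buf ≠ [] ∧ (B : ℤ) - 2 * L + 1 < lastStart buf then trim B L buf.dropLast else buf
termination_by buf.length
decreasing_by
  rename_i h
  have := List.length_pos_iff.mpr h.1
  simp only [List.length_dropLast]
  omega

/-- `PO` handles the arrival of `p` : it accepts `p`, so that the buffer holds `p` and the previous
packets in SRPT order (ties are broken arbitrarily), and then runs the dropping loop. -/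
def POAccept (B L : ℕ) (buf : List Packet) (p : Packet) (buf' : List Packet) : Prop :=
  ∃ b : List Packet, b.Perm (p :: buf) ∧ SRPTOrdered b ∧ buf' = trim B L b

/-- The arrival phase of `PO`: the packets of the slot are handled one after the other. -/
inductive POArrivalPhase (B L : ℕ) : List Packet → List Packet → List Packet → Prop
  | nil (buf : List Packet) : POArrivalPhase B L buf [] buf
  | cons {buf buf₁ buf₂ : List Packet} {p : Packet} {ps : List Packet} :
      POAccept B L buf p buf₁ → POArrivalPhase B L buf₁ ps buf₂ →
      POArrivalPhase B L buf (p :: ps) buf₂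

/-- The processing phase of `PO`: the packet of highest priority receives one cycle. -/
def serveHead : List Packet → List Packet
  | [] => []
  | p :: ps => p.serve :: ps

/-- `PORun B L σ buf sent`: if at the beginning of a slot `PO` stores `buf`, and `σ` are the
arrivals from that slot on, then `sent` can be the list of all packets that it transmits until there
are no further arrivals and its buffer is empty.  In every slot, the packets with no residual work
are transmitted, then the arrivals are handled, then one packet is processed. -/
inductive PORun (B L : ℕ) : Arrivals → List Packet → List Packet → Prop
  | done : PORun B L [] [] []
  | slot {σ : Arrivals} {buf mid sent : List Packet} :
      POArrivalPhase B L (buf.filter (fun p => p.cycles ≠ 0)) (σ.headD []) mid →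
      PORun B L σ.tail (serveHead mid) sent →
      PORun B L σ buf (buf.filter (fun p => p.cycles = 0) ++ sent)

theorem exists_poArrivalPhase (B L : ℕ) (ps buf : List Packet) :
    ∃ mid, POArrivalPhase B L buf ps mid := by
  induction ps generalizing buf with
  | nil => exact ⟨buf, .nil buf⟩
  | cons p ps ih =>
    let le : Packet → Packet → Bool := fun p q => decide (p.cycles ≤ q.cycles)
    have hs : SRPTOrdered ((p :: buf).mergeSort le) := by
      have := List.pairwise_mergeSort (le := le)
        (fun a b c h1 h2 => by simp only [le, decide_eq_true_eq] at *; omega)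
        (fun a b => by simp only [le, Bool.or_eq_true, decide_eq_true_eq]; omega) (p :: buf)
      exact this.imp (fun h => by simpa [le] using h)
    obtain ⟨mid, hmid⟩ := ih (trim B L ((p :: buf).mergeSort le))
    exact ⟨mid, .cons ⟨_, List.mergeSort_perm _ _, hs, rfl⟩ hmid⟩

/-- `PO` always has a run: without further arrivals, its buffer drains. -/
theorem exists_poRun (B L : ℕ) (σ : Arrivals) (buf : List Packet) :
    ∃ sent, PORun B L σ buf sent := by
  induction σ generalizing buf with
  | cons s σ ih =>
    obtain ⟨mid, hmid⟩ := exists_poArrivalPhase B L s (buf.filter (fun p => p.cycles ≠ 0))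
    obtain ⟨sent, hsent⟩ := ih (serveHead mid)
    exact ⟨_, .slot (σ := s :: σ) hmid hsent⟩
  | nil =>
    induction hn : (buf.map Packet.cycles).sum using Nat.strong_induction_on generalizing buf with
    | _ n ih =>
      have hle : ((buf.filter (fun p => p.cycles ≠ 0)).map Packet.cycles).sum
          ≤ (buf.map Packet.cycles).sum :=
        (List.filter_sublist.map _).sum_le_sum (by simp)
      rcases hf : buf.filter (fun p => p.cycles ≠ 0) with _ | ⟨p, rest⟩
      · refine ⟨_, .slot (mid := []) ?_ .done⟩
        rw [hf]
        exact .nil _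
      · have hp : p.cycles ≠ 0 := by
          have : p ∈ buf.filter (fun p => p.cycles ≠ 0) := by rw [hf]; simp
          simpa using (List.mem_filter.mp this).2
        rw [hf] at hle
        simp only [List.map_cons, List.sum_cons] at hle
        obtain ⟨sent, hsent⟩ := ih _ (by
          simp only [serveHead, serve, List.map_cons, List.sum_cons]; omega)
          (serveHead (p :: rest)) rfl
        refine ⟨_, .slot (mid := p :: rest) ?_ hsent⟩
        rw [hf]
        exact .nil _

/-- An arbitrary schedule handles the arrival of `p`: it goes on with any of the stored packets and
of `p` that fit into `B` bytes together.  Rejection, admission and push-out are all covered. -/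
def OfflineAccept (B : ℕ) (buf : Multiset Packet) (p : Packet) (buf' : Multiset Packet) : Prop :=
  buf' ≤ p ::ₘ buf ∧ (buf'.map Packet.size).sum ≤ B

/-- The arrival phase of an arbitrary schedule. -/
inductive OfflineArrivalPhase (B : ℕ) :
    Multiset Packet → List Packet → Multiset Packet → Prop
  | nil (buf : Multiset Packet) : OfflineArrivalPhase B buf [] buf
  | cons {buf buf₁ buf₂ : Multiset Packet} {p : Packet} {ps : List Packet} :
      OfflineAccept B buf p buf₁ → OfflineArrivalPhase B buf₁ ps buf₂ →
      OfflineArrivalPhase B buf (p :: ps) buf₂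

/-- The processing phase of an arbitrary schedule: at most one stored packet, of its choice,
receives one cycle. -/
inductive OfflineServe : Multiset Packet → Multiset Packet → Prop
  | idle (buf : Multiset Packet) : OfflineServe buf buf
  | serve (p : Packet) (rest : Multiset Packet) : OfflineServe (p ::ₘ rest) (p.serve ::ₘ rest)

/-- `OfflineRun B σ buf sent`: starting a slot with the stored packets `buf` and with the arrivals
`σ` from that slot on, some schedule for a buffer of `B` bytes transmits exactly the packets `sent`
in finitely many slots.  All decisions may depend on the whole of `σ`. -/
inductive OfflineRun (B : ℕ) : Arrivals → Multiset Packet → Multiset Packet → Prop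
  | halt (σ : Arrivals) (buf : Multiset Packet) : OfflineRun B σ buf 0
  | slot {σ : Arrivals} {buf mid next sent : Multiset Packet} :
      OfflineArrivalPhase B (buf.filter (fun p => p.cycles ≠ 0)) (σ.headD []) mid →
      OfflineServe mid next →
      OfflineRun B σ.tail next sent →
      OfflineRun B σ buf (buf.filter (fun p => p.cycles = 0) + sent)

/-- Transmitting `v` bytes on `σ` is within the factor `α` of the optimum: no schedule for a buffer
of `B` bytes, starting with the empty buffer, transmits more than `α * v` bytes. -/
def WithinFactorOfOPT (B : ℕ) (σ : Arrivals) (α : ℝ) (v : ℕ) : Prop :=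
  ∀ sent : Multiset Packet, OfflineRun B σ 0 sent →
    (((sent.map Packet.size).sum : ℕ) : ℝ) ≤ α * (v : ℝ)

end Packet

/-! Average length times number of packets is overall length, so the claim is that each packet sent
by `PO` pays for `2L` bytes of any other schedule. Run both side by side, and let `c` be the bytes
sent by the schedule minus `2L` times the number of packets sent by `PO`. The invariant `Dominated L
c O P` relates their buffers `O` and `P`.

Quantifying over every part `S` of `O` lets the invariant survive each event: transmission
(`Dominated.transmit`), arrival (`Dominated.accept`), and processing, where SRPT makes the cheapest
`T` a prefix of `P` (`Dominated.serve`). The buffer size matters only when `PO` drops packets: what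
remains is then long enough to pay for a full buffer (`Dominated.trim`). When `P` is finally empty,
the invariant for `S = O` bounds everything the schedule can still send. -/

namespace Packet

/-! ### The invariant, and bounds on work, length and trimming -/

/-- The overall residual work of a list of packets. -/
def work (l : List Packet) : ℕ := (l.map Packet.cycles).sum

/-- Whatever part `S` of the buffer `O` is chosen, the buffer `P` contains packets that need no more
work than `S`, and whose number, weighted by `2L`, is at least the length of `S` plus `c`. -/
def Dominated (L : ℕ) (c : ℤ) (O : Multiset Packet) (P : List Packet) : Prop :=
  ∀ S ≤ O, ∃ T, T.Sublist P ∧ work T ≤ (S.map Packet.cycles).sum ∧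
    c + ((S.map Packet.size).sum : ℕ) ≤ 2 * (L : ℤ) * T.length

@[simp] theorem work_nil : work [] = 0 := rfl

@[simp] theorem work_cons (p : Packet) (l : List Packet) : work (p :: l) = p.cycles + work l := by
  simp [work]

@[simp] theorem bytes_cons (p : Packet) (l : List Packet) : bytes (p :: l) = p.size + bytes l := by
  simp [bytes]

theorem work_perm {l l' : List Packet} (h : l.Perm l') : work l = work l' :=
  (h.map _).sum_eq

theorem work_sublist {l l' : List Packet} (h : l.Sublist l') : work l ≤ work l' :=
  (h.map _).sum_le_sum (by simp)

theorem work_filter (l : List Packet) : work (l.filter (fun p => p.cycles ≠ 0)) = work l := by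
  induction l with
  | nil => rfl
  | cons p l ih =>
    by_cases h : p.cycles = 0
    · rw [List.filter_cons_of_neg (by simpa using h), ih, work_cons, h, zero_add]
    · rw [List.filter_cons_of_pos (by simpa using h), work_cons, work_cons, ih]

theorem bytes_le_mul_length {L : ℕ} {l : List Packet} (h : ∀ p ∈ l, p.size ≤ L) :
    bytes l ≤ L * l.length := by
  induction l with
  | nil => simp [bytes]
  | cons p l ih =>
    have h1 := ih fun q hq => h q (by simp [hq])
    have h2 := h p (by simp)
    rw [bytes_cons, List.length_cons, mul_add]
    omega

/-- In SRPT order, the first packets need the least work among equally many packets. -/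
theorem SRPTOrdered.work_take_le {l T : List Packet} (hl : SRPTOrdered l) (h : T.Sublist l) :
    work (l.take T.length) ≤ work T := by
  induction l generalizing T with
  | nil => simp
  | cons a l ih =>
    have hl' := List.pairwise_cons.mp hl
    rcases T with _ | ⟨t, T⟩
    · simp
    · rw [List.length_cons, List.take_succ_cons, work_cons, work_cons]
      rcases List.cons_sublist_cons'.mp h with hT | ⟨rfl, hT⟩
      · have h1 := ih hl'.2 ((List.sublist_cons_self t T).trans hT)
        have h2 := hl'.1 t (hT.subset (by simp))
        omega
      · have h1 := ih hl'.2 hT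
        omega

theorem trim_prefix (B L : ℕ) (b : List Packet) : trim B L b <+: b := by
  induction b using trim.induct B L with
  | case1 b h ih =>
    rw [trim, if_pos h]
    exact ih.trans (List.dropLast_prefix b)
  | case2 b h => rw [trim, if_neg h]

/-- If `trim` drops a packet, then the remaining packets occupy more than `B - 2L` bytes. -/
theorem trim_eq_or_lt_bytes (B L : ℕ) (b : List Packet) :
    trim B L b = b ∨ (B : ℤ) - 2 * L < bytes (trim B L b) := by
  induction b using trim.induct B L with
  | case1 b h ih =>
    right
    rw [trim, if_pos h]
    rcases ih with ih | ih
    -- If the loop stops here, the packet just dropped started one byte after the end of the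
    -- remaining ones.
    · rw [ih]
      have := h.2
      rw [lastStart] at this
      push_cast at this
      linarith
    · exact ih
  | case2 b h => left; rw [trim, if_neg h]

/-! ### The invariant through a single event -/

theorem dominated_nil (L : ℕ) : Dominated L 0 0 [] := by
  intro S hS
  rw [Multiset.le_zero.mp hS]
  exact ⟨[], .slnil, by simp, by simp⟩

/-- For empty `S` the list `T` has no work, so it is empty when every packet of `P` needs a cycle.
-/
theorem Dominated.nonpos {L : ℕ} {c : ℤ} {O : Multiset Packet} {P : List Packet}
    (h : Dominated L c O P) (hP : ∀ p ∈ P, 1 ≤ p.cycles) : c ≤ 0 := by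
  obtain ⟨T, hT, hw, hc⟩ := h 0 (Multiset.zero_le _)
  rcases T with _ | ⟨t, T⟩
  · simpa using hc
  · have := hP t (hT.subset (by simp))
    simp at hw
    omega

theorem Dominated.le_count {L : ℕ} {c : ℤ} {O : Multiset Packet} {P : List Packet}
    (h : Dominated L c O P) :
    c ≤ 2 * (L : ℤ) * (P.filter (fun p => p.cycles = 0)).length := by
  obtain ⟨T, hT, hw, hc⟩ := h 0 (Multiset.zero_le _)
  have h0 : ∀ p ∈ T, p.cycles = 0 := by
    intro p hp
    have : p.cycles ≤ work T := List.single_le_sum (by simp) _ (List.mem_map_of_mem hp)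
    simp at hw
    omega
  have h1 : T.filter (fun p => p.cycles = 0) = T := List.filter_eq_self.mpr (by simpa using h0)
  have h2 := (hT.filter (fun p => decide (p.cycles = 0))).length_le
  rw [h1] at h2
  have h3 : 2 * (L : ℤ) * T.length
      ≤ 2 * (L : ℤ) * (P.filter (fun p => p.cycles = 0)).length := by gcongr
  simp at hc
  linarith

/-- Completed packets of `O` add length but no work to `S`, so they may be added to it before the
old invariant is applied. The completed packets in the resulting `T` are among those that `PO` sends
now. -/
theorem Dominated.transmit {L : ℕ} {c : ℤ} {O : Multiset Packet} {P : List Packet}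
    (h : Dominated L c O P) :
    Dominated L (c + (((O.filter (fun p => p.cycles = 0)).map Packet.size).sum : ℕ)
        - 2 * (L : ℤ) * (P.filter (fun p => p.cycles = 0)).length)
      (O.filter (fun p => p.cycles ≠ 0)) (P.filter (fun p => p.cycles ≠ 0)) := by
  intro S hS
  have hSO : O.filter (fun p => p.cycles = 0) + S ≤ O := by
    calc _ ≤ O.filter (fun p => p.cycles = 0) + O.filter (fun p => p.cycles ≠ 0) := by gcongr
      _ = O := Multiset.filter_add_not _ _
  have h0 : ((O.filter (fun p => p.cycles = 0)).map Packet.cycles).sum = 0 := by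
    rw [Multiset.sum_eq_zero_iff]
    simp only [Multiset.mem_map, Multiset.mem_filter]
    rintro x ⟨p, ⟨-, hp⟩, rfl⟩
    exact hp
  obtain ⟨T, hT, hw, hc⟩ := h _ hSO
  rw [Multiset.map_add, Multiset.sum_add] at hw hc
  refine ⟨T.filter (fun p => p.cycles ≠ 0), hT.filter _, by rw [work_filter]; omega, ?_⟩
  have h1 := (hT.filter (fun p => decide (p.cycles = 0))).length_le
  have h2 : (T.filter (fun p => p.cycles = 0)).length + (T.filter (fun p => p.cycles ≠ 0)).length
      = T.length := by
    have := List.length_eq_length_filter_add (l := T) (fun p => decide (p.cycles = 0))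
    simpa using this.symm
  have h3 : 2 * (L : ℤ) * T.length
      ≤ 2 * (L : ℤ) * (P.filter (fun p => p.cycles = 0)).length
        + 2 * (L : ℤ) * (T.filter (fun p => p.cycles ≠ 0)).length := by
    rw [← mul_add]
    gcongr
    omega
  push_cast at hc ⊢
  linarith

/-- If `S` uses `p`, so may `T`: the work grows equally, and the extra `2L` covers the length of
`p`. -/
theorem Dominated.accept {L : ℕ} {c : ℤ} {O : Multiset Packet} {P b : List Packet} {p : Packet}
    (h : Dominated L c O P) (hp : p.size ≤ L) (hb : b.Perm (p :: P)) :
    Dominated L c (p ::ₘ O) b := by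
  have key : ∀ T : List Packet, T.Subperm (p :: P) →
      ∃ T', T'.Sublist b ∧ work T' = work T ∧ T'.length = T.length := by
    intro T hT
    obtain ⟨T', h1, h2⟩ := hT.trans hb.symm.subperm
    exact ⟨T', h2, work_perm h1, h1.length_eq⟩
  intro S hS
  by_cases hpS : p ∈ S
  · obtain ⟨S, rfl⟩ := Multiset.exists_cons_of_mem hpS
    obtain ⟨T, hT, hw, hc⟩ := h S ((Multiset.cons_le_cons_iff p).mp hS)
    obtain ⟨T', h1, h2, h3⟩ := key (p :: T) (hT.cons_cons p).subperm
    refine ⟨T', h1, ?_, ?_⟩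
    · rw [h2, work_cons, Multiset.map_cons, Multiset.sum_cons]
      omega
    · rw [h3, Multiset.map_cons, Multiset.sum_cons, List.length_cons]
      push_cast at hc ⊢
      have : (p.size : ℤ) ≤ L := by exact_mod_cast hp
      linarith
  · obtain ⟨T, hT, hw, hc⟩ := h S ((Multiset.le_cons_of_notMem hpS).mp hS)
    obtain ⟨T', h1, h2, h3⟩ := key T (hT.cons p).subperm
    exact ⟨T', h1, by omega, by rw [h3]; exact hc⟩

theorem Dominated.trim {B L : ℕ} {c : ℤ} {O : Multiset Packet} {b : List Packet}
    (h : Dominated L c O b) (hB : 4 * (L : ℤ) - 2 ≤ B) (hc : c ≤ 0)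
    (hO : (O.map Packet.size).sum ≤ B) (hb : SRPTOrdered b) (hL : ∀ p ∈ b, p.size ≤ L) :
    Dominated L c O (trim B L b) := by
  rcases trim_eq_or_lt_bytes B L b with he | hlt
  · rwa [he]
  have hpre := trim_prefix B L b
  set t := Packet.trim B L b
  have ht : t = b.take t.length := List.prefix_iff_eq_take.mp hpre
  have hlen : (bytes t : ℤ) ≤ L * t.length := by
    exact_mod_cast bytes_le_mul_length fun p hp => hL p (hpre.subset hp)
  intro S hS
  obtain ⟨T, hT, hw, hcT⟩ := h S hS
  have hwT := hb.work_take_le hT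
  have hSB : (S.map Packet.size).sum ≤ B := by
    obtain ⟨R, rfl⟩ := Multiset.le_iff_exists_add.mp hS
    rw [Multiset.map_add, Multiset.sum_add] at hO
    omega
  rcases le_total T.length t.length with hle | hle
  · refine ⟨b.take T.length, ?_, by omega, ?_⟩
    · rw [ht]
      exact (List.take_prefix_take_left hle).sublist
    · rwa [List.length_take_of_le hT.length_le]
  -- `T` is too long for `t`, so all of `t` is used. Packets have at most `L` bytes and `t` has at
  -- least `B - 2L + 1`, so `2L * t.length ≥ 2B - 4L + 2 ≥ B`, which covers `S` since `c ≤ 0`.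
  · refine ⟨t, .refl t, ?_, ?_⟩
    · have : work t ≤ work (b.take T.length) := by
        rw [ht]
        exact work_sublist (List.take_prefix_take_left (hle)).sublist
      omega
    · have : ((S.map Packet.size).sum : ℤ) ≤ B := by exact_mod_cast hSB
      push_cast at this ⊢
      linarith

theorem Dominated.serve {L : ℕ} {c : ℤ} {O O' : Multiset Packet} {P : List Packet}
    (h : Dominated L c O P) (hO : OfflineServe O O') (hP : SRPTOrdered P)
    (hP1 : ∀ p ∈ P, 1 ≤ p.cycles) : Dominated L c O' (serveHead P) := by
  -- Undoing the schedule's cycle turns `S'` into a part of `O` of the same length with at most one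
  -- more unit of work.
  have key : ∀ S' ≤ O', ∃ S ≤ O, (S.map Packet.cycles).sum ≤ (S'.map Packet.cycles).sum + 1 ∧
      (S.map Packet.size).sum = (S'.map Packet.size).sum := by
    intro S' hS'
    cases hO with
    | idle => exact ⟨S', hS', by omega, rfl⟩
    | serve p rest =>
      by_cases hp : p.serve ∈ S'
      · obtain ⟨R, rfl⟩ := Multiset.exists_cons_of_mem hp
        refine ⟨p ::ₘ R, Multiset.cons_le_cons p ((Multiset.cons_le_cons_iff _).mp hS'), ?_, ?_⟩
        · simp only [Multiset.map_cons, Multiset.sum_cons, Packet.serve]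
          omega
        · simp only [Multiset.map_cons, Multiset.sum_cons, Packet.serve]
      · exact ⟨S', ((Multiset.le_cons_of_notMem hp).mp hS').trans (Multiset.le_cons_self _ _),
          by omega, rfl⟩
  intro S' hS'
  obtain ⟨S, hS, hw, hs⟩ := key S' hS'
  obtain ⟨T, hT, hwT, hc⟩ := h S hS
  rw [hs] at hc
  have h1 := hP.work_take_le hT
  rcases T with _ | ⟨t, T⟩
  · exact ⟨[], List.nil_sublist _, by simp, hc⟩
  rcases P with _ | ⟨p, P⟩
  · simp at hT
  have hp := hP1 p (by simp)
  have hle := hT.length_le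
  simp only [List.length_cons, Nat.add_le_add_iff_right] at hle
  -- Replacing `T` by a prefix of equal length includes the head, whose processing saves the missing
  -- unit of work.
  refine ⟨p.serve :: P.take T.length, (List.take_sublist _ _).cons_cons _, ?_, ?_⟩
  · rw [List.length_cons, List.take_succ_cons, work_cons] at h1
    rw [work_cons, Packet.serve]
    dsimp only
    omega
  · rwa [List.length_cons, List.length_take_of_le hle]

/-! ### Order and lengths in the buffer of `PO`; the arrival phase -/

theorem SRPTOrdered.serveHead {l : List Packet} (h : SRPTOrdered l) :
    SRPTOrdered (serveHead l) := by
  rcases l with _ | ⟨p, l⟩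
  · exact h
  · obtain ⟨h1, h2⟩ := List.pairwise_cons.mp h
    exact List.pairwise_cons.mpr ⟨fun q hq => (Nat.sub_le _ _).trans (h1 q hq), h2⟩

theorem size_mem_serveHead {l : List Packet} {q : Packet} (hq : q ∈ serveHead l) :
    ∃ p ∈ l, q.size = p.size := by
  rcases l with _ | ⟨p, l⟩
  · simp [Packet.serveHead] at hq
  · rcases List.mem_cons.mp hq with rfl | hq
    · exact ⟨p, by simp, rfl⟩
    · exact ⟨q, by simp [hq], rfl⟩

theorem POArrivalPhase.mem {B L : ℕ} {buf mid ps : List Packet}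
    (h : POArrivalPhase B L buf ps mid) : ∀ p ∈ mid, p ∈ buf ∨ p ∈ ps := by
  induction h with
  | nil => exact fun p hp => .inl hp
  | cons ha _ ih =>
    obtain ⟨b, hb, -, rfl⟩ := ha
    intro q hq
    rcases ih q hq with hq | hq
    · rcases List.mem_cons.mp (hb.mem_iff.mp ((trim_prefix _ _ _).subset hq)) with rfl | hq
      · exact .inr (by simp)
      · exact .inl hq
    · exact .inr (by simp [hq])

theorem POArrivalPhase.srptOrdered {B L : ℕ} {buf mid ps : List Packet}
    (h : POArrivalPhase B L buf ps mid) (hbuf : SRPTOrdered buf) : SRPTOrdered mid := by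
  induction h with
  | nil => exact hbuf
  | cons ha _ ih =>
    obtain ⟨b, -, hb, rfl⟩ := ha
    exact ih (hb.sublist (trim_prefix _ _ _).sublist)

theorem Dominated.arrivalPhase {B L k : ℕ} {c : ℤ} {O O' : Multiset Packet}
    {P P' ps : List Packet} (hB : 4 * (L : ℤ) - 2 ≤ B) (hPO : POArrivalPhase B L P ps P')
    (hOff : OfflineArrivalPhase B O ps O') (hps : ∀ p ∈ ps, p.Admissible L k)
    (hP : ∀ p ∈ P, p.size ≤ L) (hc : c ≤ 0) (h : Dominated L c O P) : Dominated L c O' P' := by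
  induction hPO generalizing O with
  | nil => cases hOff; exact h
  | cons ha _ ih =>
    cases hOff with
    | cons ho hOff =>
      obtain ⟨b, hb, hs, rfl⟩ := ha
      have hp := hps _ List.mem_cons_self
      have hbL : ∀ q ∈ b, q.size ≤ L := by
        intro q hq
        rcases List.mem_cons.mp (hb.mem_iff.mp hq) with rfl | hq
        · exact hp.1.2
        · exact hP q hq
      refine ih hOff (fun q hq => hps q (by simp [hq]))
        (fun q hq => hbL q ((trim_prefix _ _ _).subset hq)) ?_
      have h1 := h.accept hp.1.2 hb
      -- Parts of a smaller buffer are parts of the larger one, so rejections and push-outs by the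
      -- schedule keep the invariant.
      have h2 : Dominated L c _ b := fun S hS => h1 S (hS.trans ho.1)
      exact h2.trim hB hc ho.2 hs hbL

/-! ### Whole runs and the competitive ratio -/

/-- Without arrivals, a schedule transmits no more than it stores. -/
theorem OfflineRun.bytes_le {B : ℕ} {σ : Arrivals} {O sent : Multiset Packet}
    (h : OfflineRun B σ O sent) (hσ : σ = []) :
    (sent.map Packet.size).sum ≤ (O.map Packet.size).sum := by
  induction h with
  | halt => simp
  | @slot σ buf mid next sent ha hs _ ih =>
    subst hσ
    cases ha
    have h1 := ih rfl
    have h2 : (next.map Packet.size).sum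
        = ((buf.filter (fun p => p.cycles ≠ 0)).map Packet.size).sum := by
      generalize buf.filter (fun p => p.cycles ≠ 0) = m at hs
      cases hs with
      | idle => rfl
      | serve p rest => simp [Packet.serve]
    rw [h2] at h1
    calc _ = ((buf.filter (fun p => p.cycles = 0)).map Packet.size).sum
          + (sent.map Packet.size).sum := by rw [Multiset.map_add, Multiset.sum_add]
      _ ≤ ((buf.filter (fun p => p.cycles = 0)).map Packet.size).sum
          + ((buf.filter (fun p => p.cycles ≠ 0)).map Packet.size).sum := by gcongr
      _ = ((buf.filter (fun p => p.cycles = 0)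
          + buf.filter (fun p => p.cycles ≠ 0)).map Packet.size).sum := by
        rw [Multiset.map_add, Multiset.sum_add]
      _ = _ := by rw [Multiset.filter_add_not]

theorem admissible_headD {L k : ℕ} {σ : Arrivals}
    (hσ : ∀ slot ∈ σ, ∀ p ∈ slot, Admissible L k p) : ∀ p ∈ σ.headD [], Admissible L k p := by
  rcases σ with _ | ⟨s, σ⟩
  · simp
  · exact hσ s (by simp)

/-- Every packet that `PO` transmits pays for `2L` bytes of any other schedule. -/
theorem PORun.offline_bytes_le {B L k : ℕ} (hB : 4 * (L : ℤ) - 2 ≤ B) {σ : Arrivals}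
    {P sent : List Packet} (hPO : PORun B L σ P sent)
    (hσ : ∀ slot ∈ σ, ∀ p ∈ slot, Admissible L k p) (hP : SRPTOrdered P)
    (hPL : ∀ p ∈ P, p.size ≤ L) {c : ℤ} {O sentO : Multiset Packet} (h : Dominated L c O P)
    (hOff : OfflineRun B σ O sentO) :
    c + ((sentO.map Packet.size).sum : ℕ) ≤ 2 * (L : ℤ) * sent.length := by
  induction hPO generalizing c O sentO with
  | done =>
    -- The buffer of `PO` is empty, so `T` is too, and the invariant reads `c + bytes of O ≤ 0`.
    obtain ⟨T, hT, -, hc⟩ := h O le_rfl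
    rw [List.sublist_nil.mp hT] at hc
    have : (((sentO.map Packet.size).sum : ℕ) : ℤ) ≤ ((O.map Packet.size).sum : ℕ) := by
      exact_mod_cast hOff.bytes_le rfl
    linarith
  | @slot σ buf mid sent ha _ ih =>
    have hσ0 := admissible_headD hσ
    rw [List.length_append, Nat.cast_add]
    cases hOff with
    | halt =>
      -- The schedule stops before this slot's transmissions, so `c` may still be positive; the
      -- completed packets that `PO` is about to send cover it.
      have h1 := h.le_count
      have h2 : 0 ≤ 2 * (L : ℤ) * sent.length := by positivity
      simp only [Multiset.map_zero, Multiset.sum_zero, Nat.cast_zero]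
      linarith
    | slot hoa hos hor =>
      have hpos : ∀ p ∈ buf.filter (fun p => p.cycles ≠ 0), 1 ≤ p.cycles := fun p hp =>
        Nat.one_le_iff_ne_zero.mpr (by simpa using (List.mem_filter.mp hp).2)
      have hfL : ∀ p ∈ buf.filter (fun p => p.cycles ≠ 0), p.size ≤ L := fun p hp =>
        hPL p (List.mem_filter.mp hp).1
      have hmid := ha.srptOrdered (hP.sublist List.filter_sublist)
      have hmidpos : ∀ p ∈ mid, 1 ≤ p.cycles := fun p hp =>
        (ha.mem p hp).elim (hpos p) fun hp => (hσ0 p hp).2.1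
      have hmidL : ∀ p ∈ mid, p.size ≤ L := fun p hp =>
        (ha.mem p hp).elim (hfL p) fun hp => (hσ0 p hp).1.2
      have h1 := h.transmit
      -- After transmission every packet of `PO` needs a cycle; this gives the `c ≤ 0` that trimming
      -- requires.
      have h2 := Dominated.arrivalPhase hB ha hoa hσ0 hfL (h1.nonpos hpos) h1
      have h3 := ih (fun s hs => hσ s (List.mem_of_mem_tail hs)) hmid.serveHead
        (fun q hq => by
          obtain ⟨p, hp, he⟩ := size_mem_serveHead hq
          exact he ▸ hmidL p hp)
        (h2.serve hos hmid hmidpos) hor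
      rw [Multiset.map_add, Multiset.sum_add, Nat.cast_add]
      linarith

theorem PORun.one_le_size {B L k : ℕ} {σ : Arrivals} {P sent : List Packet}
    (h : PORun B L σ P sent) (hσ : ∀ slot ∈ σ, ∀ p ∈ slot, Admissible L k p)
    (hP : ∀ p ∈ P, 1 ≤ p.size) : ∀ p ∈ sent, 1 ≤ p.size := by
  induction h with
  | done => simp
  | slot ha _ ih =>
    intro p hp
    rcases List.mem_append.mp hp with hp | hp
    · exact hP p (List.mem_filter.mp hp).1
    · refine ih (fun s hs => hσ s (List.mem_of_mem_tail hs)) (fun q hq => ?_) p hp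
      obtain ⟨r, hr, he⟩ := size_mem_serveHead hq
      rw [he]
      exact (ha.mem r hr).elim (fun hr => hP r (List.mem_filter.mp hr).1)
        fun hr => (admissible_headD hσ r hr).1.1

theorem div_averageLength_mul_bytes {l : List Packet} (h : ∀ p ∈ l, 1 ≤ p.size) (x : ℝ) :
    x / averageLength l * bytes l = x * l.length := by
  rcases l with _ | ⟨p, l⟩
  -- For the empty list the average is `0 / 0 = 0`, but both sides vanish.
  · simp [bytes]
  · have h1 := h p (by simp)
    have hb : (bytes (p :: l) : ℝ) ≠ 0 := by
      rw [bytes_cons]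
      exact_mod_cast (by omega : p.size + bytes l ≠ 0)
    have hl : ((p :: l).length : ℝ) ≠ 0 := by simp; positivity
    rw [averageLength]
    field_simp

end Packet

theorem mainTheorem3 (B L k : ℕ) (hB : 4 * (L : ℤ) ^ 2 - 2 * (L : ℤ) < (B : ℤ))
    (σ : Packet.Arrivals) (hσ : ∀ slot ∈ σ, ∀ p ∈ slot, Packet.Admissible L k p)
    (sent : List Packet) (hsent : Packet.PORun B L σ [] sent) :
    Packet.WithinFactorOfOPT B σ (2 * (L : ℝ) / Packet.averageLength sent)
      (Packet.bytes sent) := by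
  intro sentO hO
  have hB' : 4 * (L : ℤ) - 2 ≤ B := by
    rcases Nat.eq_zero_or_pos L with rfl | hL
    · push_cast; omega
    · have : (1 : ℤ) ≤ L := by exact_mod_cast hL
      -- `4L² - 2L - (4L - 2) = 2(2L - 1)(L - 1) ≥ 0`.
      nlinarith
  have h := hsent.offline_bytes_le hB' hσ List.Pairwise.nil (by simp)
    (Packet.dominated_nil L) hO
  rw [Packet.div_averageLength_mul_bytes (hsent.one_le_size hσ (by simp))]
  rw [zero_add] at h
  exact_mod_cast h
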